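/- Let $M$ and $B$ be smooth Riemannian manifolds (finite-dimensional, without boundary) with Riemannian distances $d_M$, $d_B$, where $B$ is complete, and let $\pi : M \to B$ be a surjective smooth map of maximal rank, i.e. $(\pi_*)_x : T_xM \to T_{\pi(x)}B$ is surjective for every $x \in M$. A vector $v \in T_xM$ is called horizontal if it is orthogonal to $\ker (\pi_*)_x$; the horizontal lift through $x$ of $w \in T_{\pi(x)}B$ is the unique horizontal $v \in T_xM$ with $(\pi_*)_x v = w$. Assume that $M$ is complete or, more generally, that every $C^1$ curve $\gamma : [0,1] \to B$ has, through every $x \in \pi^{-1}(\gamma(0))$, a horizontal lift, i.e. a $C^1$ curve $\Gamma : [0,1] \to M$ with $\Gamma(0) = x$, $\pi\circ\Gamma = \gamma$ and $\Gamma'(t)$ horizontal for all $t$. Assume moreover: (UDF) there is a constant $m > 0$ such that $\operatorname{diam}(\pi^{-1}(b)) \le m$ for all $b \in B$, the diameter being taken with respect to $d_M$; (HLC) there are constants $\alpha \ge 1$ and $\beta > 0$ such that for all $b \in B$, $x \in \pi^{-1}(b)$ and $w \in T_bB$, the horizontal lift $v \in T_xM$ of $w$ through $x$ satisfies $$\frac1\alpha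 \|w\|_B - \beta \le \|v\|_M \le \alpha \|w\|_B + \beta .$$ Then $\pi$ is a rough isometry, i.e. there are constants $A \ge 1$ and $C \ge 0$ such that $$\frac1A d_M(p,q) - C \le d_B(\pi(p),\pi(q)) \le A\, d_M(p,q) + C \quad\text{for all } p, q \in M,$$ and there is $\varepsilon > 0$ such that every point of $B$ has distance less than $\varepsilon$ to the image of $\pi$. In particular, if the fibre $\pi^{-1}(b_0)$ is compact for some $b_0 \in B$, then $M$ is roughly isometric to $\pi^{-1}(b_0) \times B$ (there is a rough isometry from $M$ to it), where $\pi^{-1}(b_0)$ carries the distance induced from $(M, d_M)$ and the product carries the distance $\sqrt{d_M^2 + d_B^2}$. (If $M$ or $B$ is not connected, points in different components have distance $\infty$.) -/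

import Mathlib

open Set Bundle Manifold
open scoped ContDiff ENNReal NNReal

/-- Rough isometry. Distances are extended distances (two points in different components of a
Riemannian manifold are at distance `∞`); for ordinary metric spaces this is the usual real-valued
notion, see `isRoughIsometry_iff_dist`. -/
def IsRoughIsometry {X Y : Type*} [PseudoEMetricSpace X] [PseudoEMetricSpace Y]
    (φ : X → Y) : Prop :=
  (∃ A C : ℝ≥0, 1 ≤ A ∧ ∀ p q : X,
    edist p q / A - C ≤ edist (φ p) (φ q) ∧ edist (φ p) (φ q) ≤ A * edist p q + C) ∧
  ∃ ε : ℝ≥0, 0 < ε ∧ ∀ y : Y, Metric.infEDist y (range φ) < ε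

/-- Two spaces are roughly isometric if there is a rough isometry from one to the other. -/
def RoughlyIsometric (X Y : Type*) [PseudoEMetricSpace X] [PseudoEMetricSpace Y] : Prop :=
  ∃ φ : X → Y, IsRoughIsometry φ

theorem isRoughIsometry_iff_dist {X Y : Type*} [PseudoMetricSpace X] [PseudoMetricSpace Y]
    (φ : X → Y) :
    IsRoughIsometry φ ↔
      (∃ A C : ℝ, 1 ≤ A ∧ 0 ≤ C ∧ ∀ p q : X,
        1 / A * dist p q - C ≤ dist (φ p) (φ q) ∧ dist (φ p) (φ q) ≤ A * dist p q + C) ∧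
      ∃ ε : ℝ, 0 < ε ∧ ∀ y : Y, ∃ p : X, dist y (φ p) < ε := by
  have key : ∀ (A C : ℝ≥0), 1 ≤ A → ∀ p q : X,
      ((edist p q / A - C ≤ edist (φ p) (φ q) ∧ edist (φ p) (φ q) ≤ A * edist p q + C) ↔
      (1 / (A : ℝ) * dist p q - C ≤ dist (φ p) (φ q) ∧
        dist (φ p) (φ q) ≤ A * dist p q + C)) := by
    intro A C hA p q
    have hA0 : A ≠ 0 := (lt_of_lt_of_le one_pos hA).ne'
    rw [edist_nndist, edist_nndist, tsub_le_iff_right, ← ENNReal.coe_div hA0]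
    rw [← coe_nndist, ← coe_nndist, sub_le_iff_le_add, one_div_mul_eq_div]
    norm_cast
  constructor
  · rintro ⟨⟨A, C, hA, h⟩, ε, hε, h'⟩
    refine ⟨⟨A, C, by exact_mod_cast hA, C.2, fun p q ↦ (key A C hA p q).1 (h p q)⟩,
      ε, by exact_mod_cast hε, fun y ↦ ?_⟩
    obtain ⟨_, ⟨p, rfl⟩, hp⟩ := Metric.infEDist_lt_iff.1 (h' y)
    refine ⟨p, ?_⟩
    rw [edist_nndist] at hp
    rw [← coe_nndist]
    exact_mod_cast hp
  · rintro ⟨⟨A, C, hA, hC, h⟩, ε, hε, h'⟩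
    lift A to ℝ≥0 using by linarith
    lift C to ℝ≥0 using hC
    lift ε to ℝ≥0 using hε.le
    have hA' : 1 ≤ A := by exact_mod_cast hA
    refine ⟨⟨A, C, hA', fun p q ↦ (key A C hA' p q).2 (h p q)⟩,
      ε, by exact_mod_cast hε, fun y ↦ ?_⟩
    obtain ⟨p, hp⟩ := h' y
    refine Metric.infEDist_lt_iff.2 ⟨_, ⟨p, rfl⟩, ?_⟩
    rw [edist_nndist]
    rw [← coe_nndist] at hp
    exact_mod_cast hp

section Submersion

variable {k n : ℕ}
  {M : Type*} [TopologicalSpace M] [ChartedSpace (EuclideanSpace ℝ (Fin k)) M]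
  [RiemannianBundle (fun x : M ↦ TangentSpace (𝓡 k) x)]
  {B : Type*} [TopologicalSpace B] [ChartedSpace (EuclideanSpace ℝ (Fin n)) B]

/-- `f` has maximal rank: its derivative is surjective at every point. -/
def HasMaximalRank (k n : ℕ)
    {M : Type*} [TopologicalSpace M] [ChartedSpace (EuclideanSpace ℝ (Fin k)) M]
    {B : Type*} [TopologicalSpace B] [ChartedSpace (EuclideanSpace ℝ (Fin n)) B]
    (f : M → B) : Prop :=
  ∀ x : M, Function.Surjective (mfderiv (𝓡 k) (𝓡 n) f x)

/-- `v ∈ T_x M` is horizontal: it is orthogonal to the kernel of the derivative of `f` at `x`, which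
is the tangent space of the fibre through `x` when `f` has maximal rank. -/
def IsHorizontal (f : M → B) (x : M) (v : TangentSpace (𝓡 k) x) : Prop :=
  ∀ u : TangentSpace (𝓡 k) x, mfderiv (𝓡 k) (𝓡 n) f x u = 0 → inner ℝ v u = 0

/-- `v ∈ T_x M` is the horizontal lift through `x` of `w ∈ T_{f x} B`. -/
def IsHorizontalLift (f : M → B) (x : M) (w : TangentSpace (𝓡 n) (f x))
    (v : TangentSpace (𝓡 k) x) : Prop :=
  IsHorizontal (n := n) f x v ∧ mfderiv (𝓡 k) (𝓡 n) f x v = w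

/-- Every `C^1` curve `γ : [0, 1] → B` has, through each point `x` over `γ 0`, a horizontal lift
`Γ : [0, 1] → M`. -/
def HasHorizontalCurveLifts (k n : ℕ)
    {M : Type*} [TopologicalSpace M] [ChartedSpace (EuclideanSpace ℝ (Fin k)) M]
    [RiemannianBundle (fun x : M ↦ TangentSpace (𝓡 k) x)]
    {B : Type*} [TopologicalSpace B] [ChartedSpace (EuclideanSpace ℝ (Fin n)) B]
    (f : M → B) : Prop :=
  ∀ γ : ℝ → B, ContMDiffOn 𝓘(ℝ, ℝ) (𝓡 n) 1 γ (Icc 0 1) → ∀ x : M, f x = γ 0 →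
    ∃ Γ : ℝ → M, ContMDiffOn 𝓘(ℝ, ℝ) (𝓡 k) 1 Γ (Icc 0 1) ∧ Γ 0 = x ∧
      ∀ t ∈ Icc (0 : ℝ) 1, f (Γ t) = γ t ∧
        IsHorizontal (n := n) f (Γ t)
          (mfderivWithin 𝓘(ℝ, ℝ) (𝓡 k) Γ (Icc 0 1) t (1 : ℝ))

end Submersion

/-!
The map `f` is surjective, so the point is to compare `edist p q` with `edist (f p) (f q)`.

Horizontal lifting of tangent vectors is linear, so the additive constant `β` disappears from the
comparison of norms after scaling (`IsHorizontalLift.norm_le`): a vector and its horizontal lift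
have norms within a factor `α` of each other. Since the derivative of `f` kills the vertical part
of a vector, it expands norms by at most `α`, and pushing curves forward gives `edist (f p) (f q)
≤ α * edist p q` (`edist_map_le`).

Conversely, let `γ` be an almost shortest curve from `f p` to `f q`. If from `p` one can reach a
point `y` of the fibre over `f q` at a cost of about `α` times the length of `γ`, the bound on the
diameter of the fibres gives `edist p q ≤ α * edist (f p) (f q) + α + 1 + m`. When curves have
horizontal lifts, `y` is the endpoint of the lift of `γ`. When `M` is complete, no horizontal
lift, and so no differential equation, is needed, but only its approximate endpoint. By the
inverse function theorem there is a local section of `f` through any point, horizontal at that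
point. Composed with `γ`, it lifts `γ` for a short time with speed at most `α` times that of `γ`,
up to an arbitrarily small error, by continuity of the speed (`exists_short_lift_step`). As `M` is
complete, Zorn's lemma extends these short moves up to the end of `γ` (`exists_lift_endpoint`).

Finally, the fibre over `b₀` has finite diameter, so composing `f` with the inclusion of `B` as a
slice of the product with this fibre yields the second rough isometry.
-/

open Filter Topology MeasureTheory

/-! ### Rough isometries -/

theorem isRoughIsometry_of_edist_le {X Y : Type*} [PseudoEMetricSpace X] [PseudoEMetricSpace Y]
    {f : X → Y} (hsurj : Function.Surjective f) {A C : ℝ≥0} (hA : 1 ≤ A)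
    (hle : ∀ p q, edist (f p) (f q) ≤ A * edist p q)
    (hge : ∀ p q, edist p q ≤ A * edist (f p) (f q) + C) : IsRoughIsometry f := by
  refine ⟨⟨A, C, hA, fun p q ↦ ⟨?_, (hle p q).trans le_self_add⟩⟩, 1, one_pos, fun y ↦ ?_⟩
  · rw [tsub_le_iff_right]
    refine ENNReal.div_le_of_le_mul' ((hge p q).trans ?_)
    rw [mul_add]
    gcongr
    exact le_mul_of_one_le_left' (by exact_mod_cast hA)
  · obtain ⟨x, rfl⟩ := hsurj y
    rw [Metric.infEDist_zero_of_mem (mem_range_self x)]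
    exact one_pos

/-- If `F` is bounded, replacing the target of a surjective rough isometry by its `L²` product with
`F` keeps it a rough isometry, the component in `F` being constant. -/
theorem IsRoughIsometry.prodMk_const {X Y F : Type*} [PseudoEMetricSpace X] [PseudoEMetricSpace Y]
    [PseudoEMetricSpace F] {f : X → Y} (hf : IsRoughIsometry f) (hsurj : Function.Surjective f)
    (a : F) {D : ℝ≥0} (hD : ∀ z : F, edist z a ≤ D) :
    IsRoughIsometry fun x ↦ WithLp.toLp 2 (a, f x) := by
  have h2 : 0 < (2 : ℝ≥0∞).toReal := by norm_num
  have hfst : ∀ (y : Y) (z z' : F), edist (WithLp.toLp 2 (z, y)) (WithLp.toLp 2 (z', y)) =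
      edist z z' := by
    intro y z z'
    rw [WithLp.prod_edist_eq_add h2]
    simp only [WithLp.toLp_fst, WithLp.toLp_snd, edist_self, ENNReal.zero_rpow_of_pos h2, add_zero,
      ← ENNReal.rpow_mul, mul_one_div_cancel h2.ne', ENNReal.rpow_one]
  have hsnd : ∀ y y' : Y, edist (WithLp.toLp 2 (a, y)) (WithLp.toLp 2 (a, y')) = edist y y' := by
    intro y y'
    rw [WithLp.prod_edist_eq_add h2]
    simp only [WithLp.toLp_fst, WithLp.toLp_snd, edist_self, ENNReal.zero_rpow_of_pos h2, zero_add,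
      ← ENNReal.rpow_mul, mul_one_div_cancel h2.ne', ENNReal.rpow_one]
  obtain ⟨⟨A, C, hA, hAC⟩, -⟩ := hf
  refine ⟨⟨A, C, hA, fun p q ↦ by rw [hsnd]; exact hAC p q⟩, D + 1, by positivity, ?_⟩
  intro y
  obtain ⟨x, hx⟩ := hsurj y.snd
  refine (Metric.infEDist_le_edist_of_mem (mem_range_self x)).trans_lt ?_
  have hy : y = WithLp.toLp 2 (y.fst, f x) := by rw [hx]; rfl
  rw [hy, hfst]
  exact (hD _).trans_lt (by exact_mod_cast lt_add_one D)

/-! ### Continuation of lifts in complete spaces -/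

/-- Continuation of approximate lifts in a complete space. If from every point over `γ t`, `t < 1`,
one can move a little to a point over some `γ s`, `s > t`, at a cost of at most `l s - l t`, then
from every point over `γ 0` one reaches a point over `γ 1` at a cost of at most `l 1 - l 0`.
The pairs `(t, x)` with `f x = γ t` are ordered by "reachable at admissible cost"; completeness
bounds the chains of this order, so Zorn's lemma applies, and a maximal pair sits at time `1`.
No continuity of `l` is needed. -/
theorem exists_lift_endpoint {X Y : Type*} [EMetricSpace X] [CompleteSpace X]
    [TopologicalSpace Y] [T2Space Y] {f : X → Y} (hf : Continuous f) {γ : ℝ → Y}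
    (hγ : ContinuousOn γ (Icc 0 1)) {l : ℝ → ℝ} (hl : MonotoneOn l (Icc 0 1))
    (hstep : ∀ t ∈ Ico (0 : ℝ) 1, ∀ x, f x = γ t →
      ∃ s ∈ Ioc t 1, ∃ y, f y = γ s ∧ edist x y ≤ ENNReal.ofReal (l s - l t))
    {x : X} (hx : f x = γ 0) :
    ∃ y, f y = γ 1 ∧ edist x y ≤ ENNReal.ofReal (l 1 - l 0) := by
  let S : Type _ := {p : ℝ × X // p.1 ∈ Icc (0 : ℝ) 1 ∧ f p.2 = γ p.1}
  let r : S → S → Prop := fun p q ↦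
    p.1.1 ≤ q.1.1 ∧ edist p.1.2 q.1.2 ≤ ENNReal.ofReal (l q.1.1 - l p.1.1)
  have r_refl : ∀ p, r p p := fun p ↦ by simp [r]
  have : Std.Refl r := ⟨r_refl⟩
  have r_trans : ∀ {p q u : S}, r p q → r q u → r p u := by
    intro p q u h h'
    refine ⟨h.1.trans h'.1, (edist_triangle _ q.1.2 _).trans ((add_le_add h.2 h'.2).trans ?_)⟩
    rw [← ENNReal.ofReal_add (sub_nonneg.2 (hl p.2.1 q.2.1 h.1))
      (sub_nonneg.2 (hl q.2.1 u.2.1 h'.1))]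
    exact ENNReal.ofReal_le_ofReal (by linarith)
  -- comparable elements at the same time coincide
  have r_eq : ∀ {p q : S}, r p q → q.1.1 ≤ p.1.1 → p = q := by
    intro p q h h'
    have ht : p.1.1 = q.1.1 := le_antisymm h.1 h'
    have h2 := h.2
    rw [ht, sub_self, ENNReal.ofReal_zero, nonpos_iff_eq_zero, edist_eq_zero] at h2
    exact Subtype.ext (Prod.ext ht h2)
  have chain_bound : ∀ c : Set S, IsChain r c → c.Nonempty → ∃ ub, ∀ a ∈ c, r a ub := by
    intro c hc hne
    let T : Set ℝ := (fun p : S ↦ p.1.1) '' c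
    have hT : T.Nonempty := hne.image _
    have hTb : BddAbove T := ⟨1, by rintro _ ⟨p, -, rfl⟩; exact p.2.1.2⟩
    by_cases hmax : sSup T ∈ T
    · obtain ⟨p, hp, hpT⟩ := hmax
      refine ⟨p, fun a ha ↦ ?_⟩
      have hle : a.1.1 ≤ p.1.1 := (le_csSup hTb ⟨a, ha, rfl⟩).trans_eq hpT.symm
      rcases hc.total ha hp with h | h
      · exact h
      · rw [r_eq h hle]; exact r_refl _
    -- the times of the chain do not attain their supremum: approach it along a sequence
    obtain ⟨u, hu_mono, hu_lim, hu_mem⟩ := exists_seq_tendsto_sSup hT hTb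
    choose p hpc hpu using hu_mem
    have hp_mono : ∀ i j, i ≤ j → r (p i) (p j) := by
      intro i j hij
      have hle : (p i).1.1 ≤ (p j).1.1 := by
        have h1 := hpu i; have h2 := hpu j
        simp only at h1 h2
        rw [h1, h2]; exact hu_mono hij
      rcases hc.total (hpc i) (hpc j) with h | h
      · exact h
      · rw [r_eq h hle]; exact r_refl _
    have hsup : sSup T ∈ Icc (0 : ℝ) 1 := by
      refine ⟨?_, csSup_le hT (by rintro _ ⟨p, -, rfl⟩; exact p.2.1.2)⟩
      exact (p 0).2.1.1.trans (le_csSup hTb ⟨p 0, hpc 0, rfl⟩)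
    have hle_sup : ∀ i, (p i).1.1 ≤ sSup T := fun i ↦ le_csSup hTb ⟨p i, hpc i, rfl⟩
    have htime : Tendsto (fun i ↦ (p i).1.1) atTop (𝓝 (sSup T)) := by
      simpa only [hpu] using hu_lim
    -- the costs along the sequence converge, being monotone and bounded
    have hL_mono : Monotone (fun i ↦ l (p i).1.1) := fun i j hij ↦
      hl (p i).2.1 (p j).2.1 (hp_mono i j hij).1
    have hL_bdd : BddAbove (range fun i ↦ l (p i).1.1) :=
      ⟨l (sSup T), by rintro _ ⟨i, rfl⟩; exact hl (p i).2.1 hsup (hle_sup i)⟩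
    have hL := tendsto_atTop_ciSup hL_mono hL_bdd
    have hcauchy : CauchySeq (fun i ↦ (p i).1.2) := by
      refine EMetric.cauchySeq_iff_le_tendsto_0.2
        ⟨fun N ↦ ENNReal.ofReal (2 * ((⨆ i, l (p i).1.1) - l (p N).1.1)), ?_, ?_⟩
      · intro i j N hi hj
        refine (edist_triangle_left _ _ (p N).1.2).trans ?_
        refine (add_le_add (hp_mono N i hi).2 (hp_mono N j hj).2).trans ?_
        rw [← ENNReal.ofReal_add (sub_nonneg.2 (hL_mono hi)) (sub_nonneg.2 (hL_mono hj))]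
        apply ENNReal.ofReal_le_ofReal
        have := le_ciSup hL_bdd i
        have := le_ciSup hL_bdd j
        linarith
      · have := (hL.const_sub (⨆ i, l (p i).1.1)).const_mul 2
        simpa using ENNReal.tendsto_ofReal this
    obtain ⟨z, hz⟩ := cauchySeq_tendsto_of_complete hcauchy
    have hfz : f z = γ (sSup T) := by
      have h1 : Tendsto (fun i ↦ f (p i).1.2) atTop (𝓝 (f z)) := (hf.tendsto z).comp hz
      have h2 : Tendsto (fun i ↦ γ (p i).1.1) atTop (𝓝 (γ (sSup T))) :=
        (hγ _ hsup).tendsto.comp (tendsto_nhdsWithin_iff.2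
          ⟨htime, Eventually.of_forall fun i ↦ (p i).2.1⟩)
      simp only [(p _).2.2] at h1
      exact tendsto_nhds_unique h1 h2
    have hp_ub : ∀ i, r (p i) ⟨(sSup T, z), hsup, hfz⟩ := by
      intro i
      refine ⟨hle_sup i, ?_⟩
      refine le_of_tendsto (tendsto_const_nhds.edist hz) ?_
      filter_upwards [eventually_ge_atTop i] with j hj
      exact (hp_mono i j hj).2.trans (ENNReal.ofReal_le_ofReal
        (sub_le_sub_right (hl (p j).2.1 hsup (hle_sup j)) _))
    refine ⟨⟨(sSup T, z), hsup, hfz⟩, fun a ha ↦ ?_⟩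
    have ha_lt : a.1.1 < sSup T :=
      lt_of_le_of_ne (le_csSup hTb ⟨a, ha, rfl⟩) fun h ↦ hmax ⟨a, ha, h⟩
    obtain ⟨i, hi⟩ := (htime.eventually_const_lt ha_lt).exists
    refine r_trans ?_ (hp_ub i)
    rcases hc.total ha (hpc i) with h | h
    · exact h
    · exact absurd h.1 hi.not_ge
  -- a maximal pair among those reachable from `(0, x)`
  obtain ⟨q, hq0, hq⟩ : ∃ q : S, r ⟨(0, x), by simp, hx⟩ q ∧ ∀ a, r q a → a = q := by
    let S' := {q : S // r ⟨(0, x), by simp, hx⟩ q}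
    have : Nonempty S' := ⟨⟨_, r_refl _⟩⟩
    obtain ⟨m, hm⟩ := exists_maximal_of_nonempty_chains_bounded (α := S')
      (r := fun p q ↦ r p.1 q.1) (fun c hc hne ↦ by
        obtain ⟨ub, hub⟩ := chain_bound (Subtype.val '' c) (by
          rintro _ ⟨a, ha, rfl⟩ _ ⟨b, hb, rfl⟩ hab
          exact hc ha hb (fun h ↦ hab (congrArg _ h))) (hne.image _)
        obtain ⟨a, ha⟩ := hne
        exact ⟨⟨ub, r_trans a.2 (hub _ ⟨a, ha, rfl⟩)⟩, fun b hb ↦ hub _ ⟨b, hb, rfl⟩⟩)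
      (fun h h' ↦ r_trans h h')
    refine ⟨m.1, m.2, fun a ha ↦ ?_⟩
    have := hm ⟨a, r_trans m.2 ha⟩ ha
    exact (r_eq ha this.1).symm
  have hq1 : q.1.1 = 1 := by
    by_contra hne
    obtain ⟨s, hs, y, hy, hd⟩ := hstep q.1.1
      ⟨q.2.1.1, lt_of_le_of_ne q.2.1.2 hne⟩ q.1.2 q.2.2
    have := hq ⟨(s, y), ⟨q.2.1.1.trans hs.1.le, hs.2⟩, hy⟩ ⟨hs.1.le, hd⟩
    exact hs.1.ne' (congrArg (fun p : S ↦ p.1.1) this)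
  refine ⟨q.1.2, by rw [q.2.2, hq1], ?_⟩
  have := hq0.2
  rwa [hq1] at this

/-! ### Horizontal vectors -/

section Pointwise
variable {k n : ℕ}
  {M : Type*} [TopologicalSpace M] [ChartedSpace (EuclideanSpace ℝ (Fin k)) M]
  [RiemannianBundle (fun x : M ↦ TangentSpace (𝓡 k) x)]
  {B : Type*} [TopologicalSpace B] [ChartedSpace (EuclideanSpace ℝ (Fin n)) B]

/-- The horizontal part of a tangent vector has the same image under the derivative, and is not
longer. -/
theorem exists_isHorizontal_of_tangent (f : M → B) (x : M) (v : TangentSpace (𝓡 k) x) :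
    ∃ u : TangentSpace (𝓡 k) x, IsHorizontal (n := n) f x u ∧
      mfderiv (𝓡 k) (𝓡 n) f x u = mfderiv (𝓡 k) (𝓡 n) f x v ∧ ‖u‖ ≤ ‖v‖ := by
  have : FiniteDimensional ℝ (TangentSpace (𝓡 k) x) :=
    inferInstanceAs (FiniteDimensional ℝ (EuclideanSpace ℝ (Fin k)))
  let K : Submodule ℝ (TangentSpace (𝓡 k) x) := (mfderiv (𝓡 k) (𝓡 n) f x).ker
  refine ⟨Kᗮ.starProjection v, fun u hu ↦ ?_, ?_, ?_⟩
  · exact Submodule.inner_left_of_mem_orthogonal (K := K) hu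
      (Submodule.starProjection_apply_mem _ _)
  · have h : v - Kᗮ.starProjection v ∈ K := by
      have := Submodule.sub_starProjection_mem_orthogonal (K := Kᗮ) v
      rwa [Submodule.orthogonal_orthogonal] at this
    have h' : mfderiv (𝓡 k) (𝓡 n) f x (v - Kᗮ.starProjection v) = 0 := h
    rw [map_sub, sub_eq_zero] at h'
    exact h'.symm
  · exact Submodule.norm_starProjection_apply_le _ _

theorem IsHorizontalLift.smul {f : M → B} {x : M} {w : TangentSpace (𝓡 n) (f x)}
    {v : TangentSpace (𝓡 k) x} (h : IsHorizontalLift f x w v) (c : ℝ) :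
    IsHorizontalLift f x (c • w) (c • v) := by
  refine ⟨fun u hu ↦ ?_, by rw [map_smul, h.2]⟩
  rw [real_inner_smul_left, h.1 u hu, mul_zero]

variable [RiemannianBundle (fun b : B ↦ TangentSpace (𝓡 n) b)]

/-- Where `f` is submersive, taking horizontal lifts is a continuous linear right inverse of the
derivative. -/
theorem exists_horizontal_rightInverse {f : M → B} {x : M}
    (hx : Function.Surjective (mfderiv (𝓡 k) (𝓡 n) f x)) :
    ∃ R : TangentSpace (𝓡 n) (f x) →L[ℝ] TangentSpace (𝓡 k) x,
      (∀ w, mfderiv (𝓡 k) (𝓡 n) f x (R w) = w) ∧ ∀ w, IsHorizontal (n := n) f x (R w) := by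
  have : FiniteDimensional ℝ (TangentSpace (𝓡 k) x) :=
    inferInstanceAs (FiniteDimensional ℝ (EuclideanSpace ℝ (Fin k)))
  have : FiniteDimensional ℝ (TangentSpace (𝓡 n) (f x)) :=
    inferInstanceAs (FiniteDimensional ℝ (EuclideanSpace ℝ (Fin n)))
  let K : Submodule ℝ (TangentSpace (𝓡 k) x) := (mfderiv (𝓡 k) (𝓡 n) f x).ker
  obtain ⟨g, hg⟩ := (mfderiv (𝓡 k) (𝓡 n) f x).toLinearMap.exists_rightInverse_of_surjective
    (LinearMap.range_eq_top.2 hx)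
  let g' : TangentSpace (𝓡 n) (f x) →L[ℝ] TangentSpace (𝓡 k) x :=
    ⟨g, g.continuous_of_finiteDimensional⟩
  have hg' : ∀ w, mfderiv (𝓡 k) (𝓡 n) f x (g' w) = w := fun w ↦ congr($hg w)
  refine ⟨Kᗮ.starProjection ∘L g', fun w ↦ ?_, fun w u hu ↦ ?_⟩
  · have h : g' w - Kᗮ.starProjection (g' w) ∈ K := by
      have := Submodule.sub_starProjection_mem_orthogonal (K := Kᗮ) (g' w)
      rwa [Submodule.orthogonal_orthogonal] at this
    have h' : mfderiv (𝓡 k) (𝓡 n) f x (g' w - Kᗮ.starProjection (g' w)) = 0 := h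
    rw [map_sub, sub_eq_zero, hg'] at h'
    exact h'.symm
  · exact Submodule.inner_left_of_mem_orthogonal (K := K) hu
      (Submodule.starProjection_apply_mem _ _)

/-- The additive constant in an affine comparison between the norms of vectors and of their
horizontal lifts can be dropped: lifts are homogeneous, so the comparison holds for all multiples
of the vector. -/
theorem IsHorizontalLift.norm_le {f : M → B} {α β : ℝ} (hα : 1 ≤ α)
    (hHLC : ∀ (x : M) (w : TangentSpace (𝓡 n) (f x)) (v : TangentSpace (𝓡 k) x),
      IsHorizontalLift f x w v → 1 / α * ‖w‖ - β ≤ ‖v‖ ∧ ‖v‖ ≤ α * ‖w‖ + β)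
    {x : M} {w : TangentSpace (𝓡 n) (f x)} {v : TangentSpace (𝓡 k) x}
    (h : IsHorizontalLift f x w v) : ‖w‖ ≤ α * ‖v‖ ∧ ‖v‖ ≤ α * ‖w‖ := by
  -- a real number all of whose positive multiples are bounded by `β` is nonpositive
  have key : ∀ a : ℝ, (∀ c : ℝ, 0 < c → c * a ≤ β) → a ≤ 0 := by
    intro a ha
    by_contra! h0
    have hβ : 0 < β := (mul_pos one_pos h0).trans_le (ha 1 one_pos)
    have := ha (2 * β / a) (by positivity)
    rw [div_mul_cancel₀ _ h0.ne'] at this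
    linarith
  have hα0 : 0 < α := by linarith
  have hs : ∀ c : ℝ, 0 < c → 1 / α * (c * ‖w‖) - β ≤ c * ‖v‖ ∧ c * ‖v‖ ≤ α * (c * ‖w‖) + β := by
    intro c hc
    have := hHLC x _ _ (h.smul c)
    rwa [norm_smul, norm_smul, Real.norm_of_nonneg hc.le] at this
  constructor
  · have := key (1 / α * ‖w‖ - ‖v‖) fun c hc ↦ by nlinarith [(hs c hc).1]
    rw [sub_nonpos, one_div, inv_mul_le_iff₀ hα0] at this
    exact this
  · have := key (‖v‖ - α * ‖w‖) fun c hc ↦ by nlinarith [(hs c hc).2]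
    linarith

theorem norm_mfderiv_apply_le {f : M → B} {α : ℝ} (hα : 0 ≤ α)
    (h : ∀ (x : M) (w : TangentSpace (𝓡 n) (f x)) (v : TangentSpace (𝓡 k) x),
      IsHorizontalLift f x w v → ‖w‖ ≤ α * ‖v‖) (x : M) (v : TangentSpace (𝓡 k) x) :
    ‖mfderiv (𝓡 k) (𝓡 n) f x v‖ ≤ α * ‖v‖ := by
  obtain ⟨u, hu, huv, hle⟩ := exists_isHorizontal_of_tangent (n := n) f x v
  rw [← huv]
  exact (h x _ u ⟨hu, rfl⟩).trans (mul_le_mul_of_nonneg_left hle hα)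

end Pointwise

/-! ### Local sections of submersions -/

section LocalSection
variable {k n : ℕ}
  {M : Type*} [TopologicalSpace M] [ChartedSpace (EuclideanSpace ℝ (Fin k)) M]
  [IsManifold (𝓡 k) 1 M]
  {B : Type*} [TopologicalSpace B] [ChartedSpace (EuclideanSpace ℝ (Fin n)) B]

/-- A local section of `f` through `x` whose derivative takes values in the range of a given right
inverse `R` of the derivative of `f`. In the charts, an affine map `p` with linear part `R` is a
section of `f` to first order, hence composing it with a local inverse of `f ∘ p` gives a section.
The values of the derivative at `f x` lie in the tangent space at `σ (f x)`, those of `R` in the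
tangent space at `x`; they are compared in the model space. -/
theorem exists_local_section {f : M → B} {x : M} (hf : ContMDiffAt (𝓡 k) (𝓡 n) 1 f x)
    (R : TangentSpace (𝓡 n) (f x) →L[ℝ] TangentSpace (𝓡 k) x)
    (hR : ∀ w, mfderiv (𝓡 k) (𝓡 n) f x (R w) = w) :
    ∃ σ : B → M, ContMDiffAt (𝓡 n) (𝓡 k) 1 σ (f x) ∧ σ (f x) = x ∧
      (∀ᶠ b in 𝓝 (f x), f (σ b) = b) ∧
      ∀ w : TangentSpace (𝓡 n) (f x), ∃ w' : TangentSpace (𝓡 n) (f x),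
        (mfderiv (𝓡 n) (𝓡 k) σ (f x) w : EuclideanSpace ℝ (Fin k)) = R w' := by
  let φ := extChartAt (𝓡 k) x
  let ψ := extChartAt (𝓡 n) (f x)
  let R' : EuclideanSpace ℝ (Fin n) →L[ℝ] EuclideanSpace ℝ (Fin k) := R
  let f' : EuclideanSpace ℝ (Fin k) →L[ℝ] EuclideanSpace ℝ (Fin n) := mfderiv (𝓡 k) (𝓡 n) f x
  let p : EuclideanSpace ℝ (Fin n) → EuclideanSpace ℝ (Fin k) := fun z ↦ φ x + R' (z - ψ (f x))
  let q : EuclideanSpace ℝ (Fin k) → EuclideanSpace ℝ (Fin n) := ψ ∘ f ∘ φ.symm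
  have hp0 : p (ψ (f x)) = φ x := by simp [p]
  have hφx : φ.symm (φ x) = x := extChartAt_to_inv (I := 𝓡 k) x
  have hq0 : q (φ x) = ψ (f x) := by simp only [q, Function.comp_apply, hφx]
  have hp : ContDiff ℝ 1 p := by fun_prop
  have hpd : HasFDerivAt p R' (ψ (f x)) := by
    have : HasFDerivAt (fun z ↦ R' (z - ψ (f x))) R' (ψ (f x)) :=
      R'.hasFDerivAt.comp (ψ (f x)) ((hasFDerivAt_id (ψ (f x))).sub_const (ψ (f x)))
    exact this.const_add _
  have hq : ContDiffAt ℝ 1 q (φ x) := by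
    have := (contMDiffAt_iff.1 hf).2
    rwa [ModelWithCorners.Boundaryless.range_eq_univ, contDiffWithinAt_univ] at this
  have hqd : HasFDerivAt q f' (φ x) := by
    have : HasFDerivWithinAt q f' (range (𝓡 k)) (φ x) :=
      (hf.mdifferentiableAt one_ne_zero).hasMFDerivAt.2
    rwa [ModelWithCorners.Boundaryless.range_eq_univ, hasFDerivWithinAt_univ] at this
  have hqp : ContDiffAt ℝ 1 (q ∘ p) (ψ (f x)) := by
    refine ContDiffAt.comp _ ?_ hp.contDiffAt
    rwa [hp0]
  have hqpd : HasFDerivAt (q ∘ p) (ContinuousLinearEquiv.refl ℝ (EuclideanSpace ℝ (Fin n)) :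
      EuclideanSpace ℝ (Fin n) →L[ℝ] EuclideanSpace ℝ (Fin n)) (ψ (f x)) := by
    have h := HasFDerivAt.comp (ψ (f x)) (g := q) (g' := f') (by rwa [hp0]) hpd
    have hid : f' ∘L R' = ContinuousLinearEquiv.refl ℝ (EuclideanSpace ℝ (Fin n)) :=
      ContinuousLinearMap.ext hR
    rwa [hid] at h
  let h := hqp.localInverse hqpd one_ne_zero
  have hqp0 : (q ∘ p) (ψ (f x)) = ψ (f x) := by
    rw [Function.comp_apply, hp0, hq0]
  have h0 : h (ψ (f x)) = ψ (f x) := by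
    have := hqp.localInverse_apply_image hqpd one_ne_zero
    rwa [hqp0] at this
  have hh : ContDiffAt ℝ 1 h (ψ (f x)) := by
    have := hqp.to_localInverse hqpd one_ne_zero
    rwa [hqp0] at this
  have hinv : ∀ᶠ z in 𝓝 (ψ (f x)), q (p (h z)) = z := by
    have := (hqp.hasStrictFDerivAt' hqpd one_ne_zero).eventually_right_inverse
    rwa [hqp0] at this
  have hph0 : p (h (ψ (f x))) = φ x := by rw [h0, hp0]
  let σ : B → M := fun b ↦ φ.symm (p (h (ψ b)))
  have hph : ContDiffAt ℝ 1 (p ∘ h) (ψ (f x)) := hp.contDiffAt.comp _ hh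
  have hσ0 : σ (f x) = x := by simp only [σ, hph0, hφx]
  have hσ : ContMDiffAt (𝓡 n) (𝓡 k) 1 σ (f x) := by
    have h1 : ContMDiffAt (𝓡 n) 𝓘(ℝ, EuclideanSpace ℝ (Fin n)) 1 ψ (f x) := contMDiffAt_extChartAt
    have h2 : ContMDiffAt (𝓡 n) 𝓘(ℝ, EuclideanSpace ℝ (Fin k)) 1 (fun b ↦ p (h (ψ b))) (f x) :=
      (hph.contMDiffAt (x := ψ (f x))).comp (f x) h1
    have h3 : ContMDiffAt 𝓘(ℝ, EuclideanSpace ℝ (Fin k)) (𝓡 k) 1 φ.symm (p (h (ψ (f x)))) := by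
      rw [hph0]
      exact (contMDiffOn_extChartAt_symm x).contMDiffAt (extChartAt_target_mem_nhds x)
    exact h3.comp (f x) h2
  have hψ : Tendsto ψ (𝓝 (f x)) (𝓝 (ψ (f x))) := continuousAt_extChartAt (f x)
  have hsec : ∀ᶠ b in 𝓝 (f x), f (σ b) = b := by
    have hc : ContinuousAt (f ∘ σ) (f x) :=
      ContinuousAt.comp (by rw [hσ0]; exact hf.continuousAt) hσ.continuousAt
    have hc' : ∀ᶠ b in 𝓝 (f x), f (σ b) ∈ ψ.source := by
      refine hc.eventually_mem ?_
      rw [Function.comp_apply, hσ0]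
      exact extChartAt_source_mem_nhds (f x)
    filter_upwards [hψ.eventually hinv, hc', extChartAt_source_mem_nhds (I := 𝓡 n) (f x)]
      with b hb hb' hb''
    exact ψ.injOn hb' hb'' hb
  refine ⟨σ, hσ, hσ0, hsec, fun w ↦ ?_⟩
  -- read in the charts, the section is `p ∘ h`
  let σ' : EuclideanSpace ℝ (Fin n) →L[ℝ] EuclideanSpace ℝ (Fin k) := mfderiv (𝓡 n) (𝓡 k) σ (f x)
  have hread : HasFDerivAt (p ∘ h) σ' (ψ (f x)) := by
    have : HasFDerivWithinAt (writtenInExtChartAt (𝓡 n) (𝓡 k) (f x) σ) σ' (range (𝓡 n))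
        (ψ (f x)) := (hσ.mdifferentiableAt one_ne_zero).hasMFDerivAt.2
    rw [ModelWithCorners.Boundaryless.range_eq_univ, hasFDerivWithinAt_univ] at this
    refine this.congr_of_eventuallyEq ?_
    have ht : ∀ᶠ z in 𝓝 (ψ (f x)), p (h z) ∈ φ.target := by
      refine hph.continuousAt.eventually_mem ?_
      rw [Function.comp_apply, hph0]
      exact extChartAt_target_mem_nhds x
    filter_upwards [ht, extChartAt_target_mem_nhds (I := 𝓡 n) (f x)] with z hz hz'
    simp only [writtenInExtChartAt, Function.comp_apply, hσ0]
    change p (h z) = φ (φ.symm (p (h (ψ (ψ.symm z)))))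
    rw [ψ.right_inv hz', φ.right_inv hz]
  have hcomp : HasFDerivAt (p ∘ h) (R' ∘L fderiv ℝ h (ψ (f x))) (ψ (f x)) :=
    HasFDerivAt.comp _ (by rwa [h0]) (hh.differentiableAt one_ne_zero).hasFDerivAt
  exact ⟨fderiv ℝ h (ψ (f x)) w, congr($(hread.unique hcomp) w)⟩

end LocalSection

/-! ### Speed of curves and lifts for a short time -/

theorem isContinuousRiemannianBundle_tangentSpace (k : ℕ) (M : Type*) [TopologicalSpace M]
    [ChartedSpace (EuclideanSpace ℝ (Fin k)) M] [IsManifold (𝓡 k) ∞ M]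
    [RiemannianBundle (fun x : M ↦ TangentSpace (𝓡 k) x)]
    [h : IsContMDiffRiemannianBundle (𝓡 k) ∞ (EuclideanSpace ℝ (Fin k))
      (fun x : M ↦ TangentSpace (𝓡 k) x)] :
    IsContinuousRiemannianBundle (EuclideanSpace ℝ (Fin k))
      (fun x : M ↦ TangentSpace (𝓡 k) x) := by
  obtain ⟨g, hg, hg'⟩ := h.exists_contMDiff
  exact ⟨g, hg.continuous, hg'⟩

section Curves
variable {k n : ℕ}
  {M : Type*} [TopologicalSpace M] [ChartedSpace (EuclideanSpace ℝ (Fin k)) M]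
  [RiemannianBundle (fun x : M ↦ TangentSpace (𝓡 k) x)]
  {B : Type*} [TopologicalSpace B] [ChartedSpace (EuclideanSpace ℝ (Fin n)) B]

/-- A submersion has a local `C^1` section through any point `x`, horizontal at `x` (though in
general not at nearby points). -/
theorem exists_horizontal_local_section [IsManifold (𝓡 k) 1 M] [IsManifold (𝓡 n) 1 B]
    [RiemannianBundle (fun b : B ↦ TangentSpace (𝓡 n) b)]
    {f : M → B} {x : M} {b : B} (hb : f x = b) (hf : ContMDiffAt (𝓡 k) (𝓡 n) 1 f x)
    (hx : Function.Surjective (mfderiv (𝓡 k) (𝓡 n) f x)) :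
    ∃ σ : B → M, ContMDiffAt (𝓡 n) (𝓡 k) 1 σ b ∧ σ b = x ∧ (∀ᶠ c in 𝓝 b, f (σ c) = c) ∧
      ∀ w : TangentSpace (𝓡 n) b, IsHorizontal (n := n) f (σ b) (mfderiv (𝓡 n) (𝓡 k) σ b w) := by
  subst hb
  obtain ⟨R, hR, hRh⟩ := exists_horizontal_rightInverse hx
  obtain ⟨σ, hσ, hσ0, hsec, hσR⟩ := exists_local_section hf R hR
  refine ⟨σ, hσ, hσ0, hsec, fun w ↦ ?_⟩
  obtain ⟨w', hw'⟩ := hσR w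
  have key : ∀ y : M, y = x → IsHorizontal (n := n) f y
      (show TangentSpace (𝓡 k) y from (R w' : EuclideanSpace ℝ (Fin k))) := by
    rintro y rfl
    exact hRh w'
  have := key _ hσ0
  rw [← hw'] at this
  exact this

/-- The speed of a `C^1` curve is continuous, up to the endpoints. -/
theorem continuousOn_norm_mfderivWithin_Icc [IsManifold (𝓡 k) 1 M]
    [IsContinuousRiemannianBundle (EuclideanSpace ℝ (Fin k))
      (fun x : M ↦ TangentSpace (𝓡 k) x)] {γ : ℝ → M} {a b : ℝ} (hab : a < b)
    (hγ : ContMDiffOn 𝓘(ℝ, ℝ) (𝓡 k) 1 γ (Icc a b)) :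
    ContinuousOn (fun t ↦ ‖mfderivWithin 𝓘(ℝ, ℝ) (𝓡 k) γ (Icc a b) t (1 : ℝ)‖) (Icc a b) := by
  have h1 := hγ.continuousOn_tangentMapWithin le_rfl (uniqueDiffOn_Icc hab).uniqueMDiffOn
  have h2 : Continuous (fun t : ℝ ↦ (⟨t, (1 : ℝ)⟩ : TangentBundle 𝓘(ℝ, ℝ) ℝ)) := by
    have := (tangentBundleModelSpaceHomeomorph 𝓘(ℝ, ℝ)).symm.continuous.comp
      (Continuous.prodMk_left (X := ℝ) (1 : ℝ))
    exact this
  have h3 : ContinuousOn (fun t : ℝ ↦ (⟨γ t, mfderivWithin 𝓘(ℝ, ℝ) (𝓡 k) γ (Icc a b) t (1 : ℝ)⟩ :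
      TotalSpace (EuclideanSpace ℝ (Fin k)) (fun x : M ↦ TangentSpace (𝓡 k) x))) (Icc a b) :=
    h1.comp h2.continuousOn fun t ht ↦ ht
  have h4 := (h3.inner_bundle h3).sqrt
  simpa only [← norm_eq_sqrt_real_inner] using h4

/-- Curves that agree on `s` have the same speed there. The two velocities live in tangent spaces at
points that are only propositionally equal, so that this is not a mere rewriting. -/
theorem norm_mfderivWithin_congr {γ η : ℝ → M} {s : Set ℝ} {t : ℝ} (h : EqOn γ η s) (ht : t ∈ s) :
    ‖mfderivWithin 𝓘(ℝ, ℝ) (𝓡 k) γ s t (1 : ℝ)‖ = ‖mfderivWithin 𝓘(ℝ, ℝ) (𝓡 k) η s t (1 : ℝ)‖ := by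
  have key : ∀ {x y : M}, x = y → ∀ v : EuclideanSpace ℝ (Fin k),
      ‖(show TangentSpace (𝓡 k) x from v)‖ = ‖(show TangentSpace (𝓡 k) y from v)‖ := by
    rintro x _ rfl v
    rfl
  have hd : mfderivWithin 𝓘(ℝ, ℝ) (𝓡 k) γ s t = mfderivWithin 𝓘(ℝ, ℝ) (𝓡 k) η s t :=
    mfderivWithin_congr h (h ht)
  exact (key (h ht) _).trans congr(‖(show TangentSpace (𝓡 k) (η t) from $hd (1 : ℝ))‖)

variable [RiemannianBundle (fun b : B ↦ TangentSpace (𝓡 n) b)]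

theorem norm_mfderivWithin_le_of_isHorizontal {f : M → B} {α : ℝ}
    (hα : ∀ (x : M) (w : TangentSpace (𝓡 n) (f x)) (v : TangentSpace (𝓡 k) x),
      IsHorizontalLift f x w v → ‖v‖ ≤ α * ‖w‖)
    {γ : ℝ → B} {Γ : ℝ → M} {s : Set ℝ} {t : ℝ} (hf : MDifferentiableAt (𝓡 k) (𝓡 n) f (Γ t))
    (hΓ : MDifferentiableWithinAt 𝓘(ℝ, ℝ) (𝓡 k) Γ s t) (hs : UniqueDiffWithinAt ℝ s t)
    (ht : t ∈ s) (hγ : EqOn (f ∘ Γ) γ s)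
    (hor : IsHorizontal (n := n) f (Γ t) (mfderivWithin 𝓘(ℝ, ℝ) (𝓡 k) Γ s t (1 : ℝ))) :
    ‖mfderivWithin 𝓘(ℝ, ℝ) (𝓡 k) Γ s t (1 : ℝ)‖ ≤
      α * ‖mfderivWithin 𝓘(ℝ, ℝ) (𝓡 n) γ s t (1 : ℝ)‖ := by
  have h1 := hα (Γ t) _ _ ⟨hor, rfl⟩
  have h2 : mfderivWithin 𝓘(ℝ, ℝ) (𝓡 n) (f ∘ Γ) s t =
      (mfderiv (𝓡 k) (𝓡 n) f (Γ t)).comp (mfderivWithin 𝓘(ℝ, ℝ) (𝓡 k) Γ s t) :=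
    mfderiv_comp_mfderivWithin t hf hΓ hs.uniqueMDiffWithinAt
  rw [← norm_mfderivWithin_congr hγ ht, h2]
  exact h1

theorem pathELength_le_of_norm_le {γ : ℝ → B} {Γ : ℝ → M} {a b α δ : ℝ} (hα : 0 ≤ α) (hδ : 0 ≤ δ)
    (h : ∀ t ∈ Ioo a b, ‖mfderiv 𝓘(ℝ, ℝ) (𝓡 k) Γ t (1 : ℝ)‖ ≤
      α * ‖mfderiv 𝓘(ℝ, ℝ) (𝓡 n) γ t (1 : ℝ)‖ + δ) :
    pathELength (𝓡 k) Γ a b ≤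
      ENNReal.ofReal α * pathELength (𝓡 n) γ a b + ENNReal.ofReal (δ * (b - a)) := by
  rw [pathELength_eq_lintegral_mfderiv_Ioo, pathELength_eq_lintegral_mfderiv_Ioo,
    ← lintegral_const_mul' _ _ ENNReal.ofReal_ne_top]
  have hc : ENNReal.ofReal (δ * (b - a)) = ∫⁻ _ in Ioo a b, ENNReal.ofReal δ := by
    rw [setLIntegral_const, Real.volume_Ioo, ENNReal.ofReal_mul hδ]
  rw [hc, ← lintegral_add_right _ measurable_const]
  refine setLIntegral_mono' measurableSet_Ioo fun t ht ↦ ?_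
  rw [← ofReal_norm, ← ofReal_norm, ← ENNReal.ofReal_mul hα,
    ← ENNReal.ofReal_add (by positivity) hδ]
  exact ENNReal.ofReal_le_ofReal (h t ht)

/-- A `C^1` curve `γ` can be lifted for a short time at almost the optimal cost `α`: the lift is
`σ ∘ γ` for a local section `σ` that is horizontal at the starting point. There its speed is at most
`α` times the speed of `γ`, hence by continuity it is at most this plus `δ` for a short time. -/
theorem exists_short_lift_step [IsManifold (𝓡 k) 1 M] [IsManifold (𝓡 n) 1 B]
    [IsContinuousRiemannianBundle (EuclideanSpace ℝ (Fin k)) (fun x : M ↦ TangentSpace (𝓡 k) x)]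
    [IsContinuousRiemannianBundle (EuclideanSpace ℝ (Fin n)) (fun b : B ↦ TangentSpace (𝓡 n) b)]
    {f : M → B} (hf : ContMDiff (𝓡 k) (𝓡 n) 1 f) (hrank : HasMaximalRank k n f)
    {α : ℝ} (hα0 : 0 ≤ α)
    (hα : ∀ (x : M) (w : TangentSpace (𝓡 n) (f x)) (v : TangentSpace (𝓡 k) x),
      IsHorizontalLift f x w v → ‖v‖ ≤ α * ‖w‖)
    {γ : ℝ → B} {a b : ℝ} (hab : a < b) (hγ : ContMDiffOn 𝓘(ℝ, ℝ) (𝓡 n) 1 γ (Icc a b))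
    {x : M} (hx : f x = γ a) {δ : ℝ} (hδ : 0 < δ) :
    ∃ s ∈ Ioc a b, ∃ y, f y = γ s ∧ riemannianEDist (𝓡 k) x y ≤
      ENNReal.ofReal α * pathELength (𝓡 n) γ a s + ENNReal.ofReal (δ * (s - a)) := by
  obtain ⟨σ, hσ, hσ0, hsec, hor⟩ :=
    exists_horizontal_local_section hx hf.contMDiffAt (hrank x)
  let Γ : ℝ → M := σ ∘ γ
  have shrink : ∀ {b : ℝ} {p : ℝ → Prop}, a < b → (∀ᶠ t in 𝓝[Icc a b] a, p t) →
      ∃ c ∈ Ioc a b, ∀ t ∈ Icc a c, p t := by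
    intro b p hab hp
    rw [nhdsWithin_Icc_eq_nhdsGE hab] at hp
    obtain ⟨u, hu, hup⟩ := mem_nhdsGE_iff_exists_Icc_subset.1 hp
    exact ⟨min u b, ⟨lt_min hu hab, min_le_right _ _⟩,
      fun t ht ↦ hup ⟨ht.1, ht.2.trans (min_le_left _ _)⟩⟩
  have hγa : Tendsto γ (𝓝[Icc a b] a) (𝓝 (γ a)) :=
    (hγ.continuousOn a (left_mem_Icc.2 hab.le)).tendsto
  obtain ⟨c, hc, hcp⟩ := shrink hab
    (hγa.eventually (((contMDiffAt_iff_contMDiffAt_nhds (by simp)).1 hσ).and hsec))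
  have hcb : Icc a c ⊆ Icc a b := Icc_subset_Icc_right hc.2
  have hγc := hγ.mono hcb
  have hΓ : ContMDiffOn 𝓘(ℝ, ℝ) (𝓡 k) 1 Γ (Icc a c) := fun t ht ↦
    (hcp t ht).1.comp_contMDiffWithinAt t (hγc t ht)
  have hfΓ : EqOn (f ∘ Γ) γ (Icc a c) := fun t ht ↦ (hcp t ht).2
  have ha : a ∈ Icc a c := left_mem_Icc.2 hc.1.le
  have hΓa : mfderivWithin 𝓘(ℝ, ℝ) (𝓡 k) Γ (Icc a c) a =
      (mfderiv (𝓡 n) (𝓡 k) σ (γ a)).comp (mfderivWithin 𝓘(ℝ, ℝ) (𝓡 n) γ (Icc a c) a) :=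
    mfderiv_comp_mfderivWithin a (hσ.mdifferentiableAt one_ne_zero)
      (hγc.mdifferentiableOn one_ne_zero a ha)
      (uniqueDiffOn_Icc hc.1 a ha).uniqueMDiffWithinAt
  have hspeed := norm_mfderivWithin_le_of_isHorizontal hα
    (hf.mdifferentiable one_ne_zero _) (hΓ.mdifferentiableOn one_ne_zero a ha)
    (uniqueDiffOn_Icc hc.1 a ha) ha hfΓ (by rw [hΓa]; exact hor _)
  have hev := ((continuousOn_norm_mfderivWithin_Icc hc.1 hΓ) a ha).eventually_lt
    ((((continuousOn_norm_mfderivWithin_Icc hc.1 hγc) a ha).const_mul α).add_const δ)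
    (lt_of_le_of_lt hspeed (lt_add_of_pos_right _ hδ))
  obtain ⟨s, hs, hsp⟩ := shrink hc.1 hev
  have hsc : s ∈ Icc a c := ⟨hs.1.le, hs.2⟩
  refine ⟨s, ⟨hs.1, hs.2.trans hc.2⟩, Γ s, hfΓ hsc, ?_⟩
  refine (riemannianEDist_le_pathELength (hΓ.mono (Icc_subset_Icc_right hs.2)) hσ0 rfl
    hs.1.le).trans (pathELength_le_of_norm_le hα0 hδ.le fun t ht ↦ ?_)
  have := (hsp t ⟨ht.1.le, ht.2.le⟩).le
  have hn : Icc a c ∈ 𝓝 t := Icc_mem_nhds ht.1 (ht.2.trans_le hs.2)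
  rwa [mfderivWithin_of_mem_nhds hn, mfderivWithin_of_mem_nhds hn] at this

end Curves

/-! ### Distances in the base and in the total space -/

section Distance
variable {k n : ℕ}
  {M : Type*} [EMetricSpace M] [ChartedSpace (EuclideanSpace ℝ (Fin k)) M]
  [RiemannianBundle (fun x : M ↦ TangentSpace (𝓡 k) x)]
  [IsRiemannianManifold (𝓡 k) M]
  {B : Type*} [EMetricSpace B] [ChartedSpace (EuclideanSpace ℝ (Fin n)) B]
  [RiemannianBundle (fun b : B ↦ TangentSpace (𝓡 n) b)]

theorem edist_map_le [IsRiemannianManifold (𝓡 n) B] {f : M → B} (hf : ContMDiff (𝓡 k) (𝓡 n) 1 f)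
    {α : ℝ} (hα0 : 0 < α) (hα : ∀ (x : M) (v : TangentSpace (𝓡 k) x),
      ‖mfderiv (𝓡 k) (𝓡 n) f x v‖ ≤ α * ‖v‖) (p q : M) :
    edist (f p) (f q) ≤ ENNReal.ofReal α * edist p q := by
  by_contra! hlt
  have h0 : ENNReal.ofReal α ≠ 0 := (ENNReal.ofReal_pos.2 hα0).ne'
  rw [mul_comm, ← ENNReal.lt_div_iff_mul_lt (.inl h0) (.inl ENNReal.ofReal_ne_top),
    IsRiemannianManifold.out (I := 𝓡 k) p q] at hlt
  obtain ⟨Γ, hp, hq, hΓ, hL⟩ := exists_lt_of_riemannianEDist_lt hlt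
  rw [ENNReal.lt_div_iff_mul_lt (.inl h0) (.inl ENNReal.ofReal_ne_top), mul_comm] at hL
  refine hL.not_ge ?_
  rw [IsRiemannianManifold.out (I := 𝓡 n) (f p) (f q)]
  refine (riemannianEDist_le_pathELength (γ := f ∘ Γ) (hf.comp_contMDiffOn hΓ)
    (by simp [hp]) (by simp [hq]) zero_le_one).trans ?_
  have := pathELength_le_of_norm_le (k := n) (n := k) (γ := Γ) (Γ := f ∘ Γ)
    (a := 0) (b := 1) hα0.le le_rfl fun t ht ↦ ?_
  · simpa using this
  have hΓt : MDifferentiableAt 𝓘(ℝ, ℝ) (𝓡 k) Γ t :=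
    (hΓ.contMDiffAt (Icc_mem_nhds ht.1 ht.2)).mdifferentiableAt one_ne_zero
  rw [mfderiv_comp t (hf.mdifferentiable one_ne_zero _) hΓt, add_zero]
  exact hα _ _

theorem exists_lift_endpoint_of_hasHorizontalCurveLifts {f : M → B}
    (hf : ContMDiff (𝓡 k) (𝓡 n) 1 f) (hlift : HasHorizontalCurveLifts k n f)
    {α : ℝ} (hα0 : 0 ≤ α)
    (hα : ∀ (x : M) (w : TangentSpace (𝓡 n) (f x)) (v : TangentSpace (𝓡 k) x),
      IsHorizontalLift f x w v → ‖v‖ ≤ α * ‖w‖)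
    {γ : ℝ → B} (hγ : ContMDiffOn 𝓘(ℝ, ℝ) (𝓡 n) 1 γ (Icc 0 1)) {x : M} (hx : f x = γ 0) :
    ∃ y, f y = γ 1 ∧ edist x y ≤ ENNReal.ofReal α * pathELength (𝓡 n) γ 0 1 := by
  obtain ⟨Γ, hΓ, hΓ0, h⟩ := hlift γ hγ x hx
  refine ⟨Γ 1, (h 1 (right_mem_Icc.2 zero_le_one)).1, ?_⟩
  rw [IsRiemannianManifold.out (I := 𝓡 k) x]
  refine (riemannianEDist_le_pathELength hΓ hΓ0 rfl zero_le_one).trans ?_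
  have := pathELength_le_of_norm_le (k := k) (n := n) (γ := γ) (Γ := Γ) (a := 0) (b := 1) hα0 le_rfl
    fun t ht ↦ ?_
  · simpa using this
  have ht' := Ioo_subset_Icc_self ht
  have hn : Icc (0 : ℝ) 1 ∈ 𝓝 t := Icc_mem_nhds ht.1 ht.2
  have := norm_mfderivWithin_le_of_isHorizontal hα (hf.mdifferentiable one_ne_zero _)
    (hΓ.mdifferentiableOn one_ne_zero t ht') (uniqueDiffOn_Icc zero_lt_one t ht') ht'
    (fun s hs ↦ (h s hs).1) (h t ht').2
  rwa [mfderivWithin_of_mem_nhds hn, mfderivWithin_of_mem_nhds hn, ← add_zero (α * _)] at this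

/-- In a complete total space the endpoints of curves can be lifted at a cost arbitrarily close to
`α` times the length. The lifting curve is not constructed: the short lifts are continued by
`exists_lift_endpoint`, with the cost of a time interval given by `α` times the length of `γ` on it
plus `δ` times its duration. -/
theorem exists_lift_endpoint_of_completeSpace [CompleteSpace M] [IsManifold (𝓡 k) 1 M]
    [IsManifold (𝓡 n) 1 B]
    [IsContinuousRiemannianBundle (EuclideanSpace ℝ (Fin k)) (fun x : M ↦ TangentSpace (𝓡 k) x)]
    [IsContinuousRiemannianBundle (EuclideanSpace ℝ (Fin n)) (fun b : B ↦ TangentSpace (𝓡 n) b)]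
    {f : M → B} (hf : ContMDiff (𝓡 k) (𝓡 n) 1 f) (hrank : HasMaximalRank k n f)
    {α : ℝ} (hα0 : 0 ≤ α)
    (hα : ∀ (x : M) (w : TangentSpace (𝓡 n) (f x)) (v : TangentSpace (𝓡 k) x),
      IsHorizontalLift f x w v → ‖v‖ ≤ α * ‖w‖)
    {γ : ℝ → B} (hγ : ContMDiffOn 𝓘(ℝ, ℝ) (𝓡 n) 1 γ (Icc 0 1))
    (hγL : pathELength (𝓡 n) γ 0 1 ≠ ⊤) {x : M} (hx : f x = γ 0) {δ : ℝ} (hδ : 0 < δ) :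
    ∃ y, f y = γ 1 ∧ edist x y ≤
      ENNReal.ofReal α * pathELength (𝓡 n) γ 0 1 + ENNReal.ofReal δ := by
  have hfin : ∀ {s t : ℝ}, 0 ≤ s → t ≤ 1 → pathELength (𝓡 n) γ s t ≠ ⊤ := fun hs ht ↦
    ((pathELength_mono hs ht).trans_lt hγL.lt_top).ne
  let l : ℝ → ℝ := fun t ↦ α * (pathELength (𝓡 n) γ 0 t).toReal + δ * t
  have hl : ∀ {s t : ℝ}, 0 ≤ s → s ≤ t → t ≤ 1 →
      l t - l s = α * (pathELength (𝓡 n) γ s t).toReal + δ * (t - s) := by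
    intro s t hs hst ht
    simp only [l]
    rw [← pathELength_add hs hst, ENNReal.toReal_add (hfin le_rfl (hst.trans ht)) (hfin hs ht)]
    ring
  have hl' : ∀ {s t : ℝ}, 0 ≤ s → s ≤ t → t ≤ 1 → ENNReal.ofReal (l t - l s) =
      ENNReal.ofReal α * pathELength (𝓡 n) γ s t + ENNReal.ofReal (δ * (t - s)) := by
    intro s t hs hst ht
    have : 0 ≤ t - s := sub_nonneg.2 hst
    rw [hl hs hst ht, ENNReal.ofReal_add (by positivity) (by positivity), ENNReal.ofReal_mul hα0,
      ENNReal.ofReal_toReal (hfin hs ht)]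
  have hmono : MonotoneOn l (Icc 0 1) := by
    intro s hs t ht hst
    have : 0 ≤ t - s := sub_nonneg.2 hst
    rw [← sub_nonneg, hl hs.1 hst ht.2]
    positivity
  obtain ⟨y, hy, hd⟩ := exists_lift_endpoint hf.continuous hγ.continuousOn hmono
    (fun t ht z hz ↦ by
      obtain ⟨s, hs, y, hy, hd⟩ := exists_short_lift_step hf hrank hα0 hα ht.2
        (hγ.mono (Icc_subset_Icc_left ht.1)) hz hδ
      refine ⟨s, hs, y, hy, ?_⟩
      rwa [hl' ht.1 hs.1.le hs.2, IsRiemannianManifold.out (I := 𝓡 k) z y]) hx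
  rw [hl' le_rfl zero_le_one le_rfl, sub_zero, mul_one] at hd
  exact ⟨y, hy, hd⟩

end Distance

theorem theorem4p2p3 {k n : ℕ}
    -- `M` is a smooth Riemannian manifold of dimension `k`
    {M : Type*} [EMetricSpace M] [ChartedSpace (EuclideanSpace ℝ (Fin k)) M]
    [IsManifold (𝓡 k) ∞ M]
    [RiemannianBundle (fun x : M ↦ TangentSpace (𝓡 k) x)]
    [IsContMDiffRiemannianBundle (𝓡 k) ∞ (EuclideanSpace ℝ (Fin k))
      (fun x : M ↦ TangentSpace (𝓡 k) x)]
    [IsRiemannianManifold (𝓡 k) M]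
    -- `B` is a complete smooth Riemannian manifold of dimension `n`
    {B : Type*} [EMetricSpace B] [ChartedSpace (EuclideanSpace ℝ (Fin n)) B]
    [IsManifold (𝓡 n) ∞ B]
    [RiemannianBundle (fun b : B ↦ TangentSpace (𝓡 n) b)]
    [IsContMDiffRiemannianBundle (𝓡 n) ∞ (EuclideanSpace ℝ (Fin n))
      (fun b : B ↦ TangentSpace (𝓡 n) b)]
    [IsRiemannianManifold (𝓡 n) B] [CompleteSpace B]
    -- `f` is an onto smooth map with maximal rank
    (f : M → B) (hf : ContMDiff (𝓡 k) (𝓡 n) ∞ f) (hsurj : Function.Surjective f)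
    (hrank : HasMaximalRank k n f)
    -- `M` is complete or, more generally, every `C^1` curve in `B` has horizontal lifts
    (hlift : CompleteSpace M ∨ HasHorizontalCurveLifts k n f)
    -- uniform bound on the diameters of the fibres
    (m : ℝ) (_hm : 0 < m) (hUDF : ∀ b : B, Metric.ediam (f ⁻¹' {b}) ≤ ENNReal.ofReal m)
    -- control of the lengths of horizontal lifts
    (α β : ℝ) (hα : 1 ≤ α) (hβ : 0 < β)
    (hHLC : ∀ (x : M) (w : TangentSpace (𝓡 n) (f x)) (v : TangentSpace (𝓡 k) x),
      IsHorizontalLift f x w v → 1 / α * ‖w‖ - β ≤ ‖v‖ ∧ ‖v‖ ≤ α * ‖w‖ + β) :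
    IsRoughIsometry f ∧
      ∀ b₀ : B, IsCompact (f ⁻¹' {b₀}) →
        RoughlyIsometric M (WithLp 2 ((f ⁻¹' {b₀} : Set M) × B)) := by
  have := isContinuousRiemannianBundle_tangentSpace k M
  have := isContinuousRiemannianBundle_tangentSpace n B
  have hf1 : ContMDiff (𝓡 k) (𝓡 n) 1 f := hf.of_le (by simp)
  have hα0 : 0 < α := one_pos.trans_le hα
  have hlin : ∀ (x : M) (w : TangentSpace (𝓡 n) (f x)) (v : TangentSpace (𝓡 k) x),
      IsHorizontalLift f x w v → ‖w‖ ≤ α * ‖v‖ ∧ ‖v‖ ≤ α * ‖w‖ :=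
    fun x w v h ↦ h.norm_le hα hHLC
  have hupper := edist_map_le hf1 hα0
    (norm_mfderiv_apply_le hα0.le fun x w v h ↦ (hlin x w v h).1)
  have hcurve : ∀ γ : ℝ → B, ContMDiffOn 𝓘(ℝ, ℝ) (𝓡 n) 1 γ (Icc 0 1) →
      pathELength (𝓡 n) γ 0 1 ≠ ⊤ → ∀ x, f x = γ 0 → ∃ y, f y = γ 1 ∧
        edist x y ≤ ENNReal.ofReal α * pathELength (𝓡 n) γ 0 1 + ENNReal.ofReal 1 := by
    intro γ hγ hL x hx
    rcases hlift with hM | hM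
    · exact exists_lift_endpoint_of_completeSpace hf1 hrank hα0.le
        (fun x w v h ↦ (hlin x w v h).2) hγ hL hx one_pos
    · obtain ⟨y, hy, hd⟩ := exists_lift_endpoint_of_hasHorizontalCurveLifts hf1 hM hα0.le
        (fun x w v h ↦ (hlin x w v h).2) hγ hx
      exact ⟨y, hy, hd.trans le_self_add⟩
  have hlower : ∀ p q, edist p q ≤ ENNReal.ofReal α * edist (f p) (f q) +
      (ENNReal.ofReal α + 1 + ENNReal.ofReal m) := by
    intro p q
    rcases eq_or_ne (edist (f p) (f q)) ⊤ with htop | htop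
    · simp [htop, ENNReal.mul_top (ENNReal.ofReal_pos.2 hα0).ne']
    have hlt : riemannianEDist (𝓡 n) (f p) (f q) < edist (f p) (f q) + 1 := by
      rw [← IsRiemannianManifold.out (I := 𝓡 n)]
      exact ENNReal.lt_add_right htop one_ne_zero
    obtain ⟨γ, h0, h1, hγ, hL⟩ := exists_lt_of_riemannianEDist_lt hlt
    obtain ⟨y, hy, hd⟩ := hcurve γ hγ hL.ne_top p h0.symm
    -- the endpoint of the lift lies in the fibre of `q`
    have hyq : edist y q ≤ ENNReal.ofReal m :=
      (Metric.edist_le_ediam_of_mem (by simp [hy, h1]) (by simp)).trans (hUDF (f q))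
    calc edist p q ≤ edist p y + edist y q := edist_triangle _ _ _
      _ ≤ (ENNReal.ofReal α * (edist (f p) (f q) + 1) + 1) + ENNReal.ofReal m := by
        refine add_le_add (hd.trans ?_) hyq
        rw [ENNReal.ofReal_one]
        gcongr
      _ = _ := by ring
  have hrough : IsRoughIsometry f :=
    isRoughIsometry_of_edist_le (A := α.toNNReal) (C := α.toNNReal + 1 + m.toNNReal) hsurj
      (by simpa using hα) hupper hlower
  refine ⟨hrough, fun b₀ _ ↦ ?_⟩
  obtain ⟨x₀, hx₀⟩ := hsurj b₀
  exact ⟨_, hrough.prodMk_const hsurj (⟨x₀, hx₀⟩ : (f ⁻¹' {b₀} : Set M)) (D := m.toNNReal)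
    fun z ↦ (Metric.edist_le_ediam_of_mem z.2 hx₀).trans (hUDF b₀)⟩
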